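/- Let $n\ge 2$, let $e_1,\dots,e_n$ be the standard basis of Euclidean space $\mathbb R^n$, and take the root system of type $\mathsf B_n$, consisting of the vectors $\pm e_j$ and $\pm e_j\pm e_k$ ($j\ne k$), with simple roots $\alpha_j=e_j-e_{j+1}$ ($1\le j<n$), $\alpha_n=e_n$, and highest root $\theta=\alpha_1+2\sum_{j=2}^n\alpha_j=e_1+e_2=\theta^\vee$. Let $W_0$ be its finite Weyl group, and let $P=\{v\in\mathbb R^n : (\alpha,v)\in\mathbb Z\text{ for all roots }\alpha\}$, the lattice of coweights. Let $\widetilde W=W_0\ltimes P$ be the extended affine Weyl group of type $\mathsf B_n^{(1)}$, acting on $\mathbb R^n$ by affine transformations, where $P$ acts by translations $t_v$. For $1\le i\le n$ let $\omega_i\in\widetilde W$ be the translation by the $i$-th fundamental coweight $e_1+\cdots+e_i$ (the vector dual to $\alpha_i$ with respect to the basis $\alpha_1,\dots,\alpha_n$). Let $s_j$ be the reflection in $\alpha_j$ for $1\le j\le n$, let $s_0=t_{\theta^\vee}r_\theta$, where $r_\theta$ is the reflection in $\theta$, and put $[k,l]=s_ks_{k+1}\cdots s_l$ for $1\le k\le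 l\le n$. Let $\Lambda\subset\widetilde W$ be the subgroup of the elements that permute the simple affine roots $\alpha_0=1-\theta,\alpha_1,\dots,\alpha_n$ (regarded as affine functions on $\mathbb R^n$), and let $\pi_1\in\Lambda$ be the element $x\mapsto(1-x_1,x_2,\dots,x_n)$, which interchanges $\alpha_0$ and $\alpha_1$ and fixes $\alpha_2,\dots,\alpha_n$. The length $\ell(w)$ of $w\in\widetilde W$ is the least $r$ for which $w=\lambda s_{j_1}\cdots s_{j_r}$ with $\lambda\in\Lambda$ and $j_1,\dots,j_r\in\{0,\dots,n\}$, and such an expression with $r=\ell(w)$ is called reduced. Let $1\le i\le n$. If $i$ is odd, then $$\omega_i=\pi_1\,[1,n]\,\big(s_0[2,n][1,n]\big)^{\frac{i-1}{2}}\,[n-i,n-1]\cdots[2,i+1]\,[1,i].$$ If $i$ is even, then $$\omega_i=\big(s_0[2,n][1,n]\big)^{\frac{i}{2}}\,[n-i,n-1]\cdots[2,i+1]\,[1,i].$$ Here $[n-i,n-1]\cdots[1,i]$ is the product of the elements $[m,m+i-1]$ for $m=n-i,n-i-1,\dots,1$, in this order; it is empty if $i=n$. These expressions are reduced, with $i(2n-i)$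 simple reflections each, so that $\ell(\omega_i)=i(2n-i)$. -/

import Mathlib

namespace AffineB

noncomputable section

/-- The Euclidean space `ℝⁿ`. -/
abbrev V (n : ℕ) : Type := EuclideanSpace ℝ (Fin n)

/-- The group of invertible affine transformations of `ℝⁿ`; the product is composition,
`(g * h) x = g (h x)`. -/
abbrev Aff (n : ℕ) : Type := V n ≃ᵃ[ℝ] V n

/-- The standard basis vector `e_j` of `ℝⁿ`, numbered from `1` (so `1 ≤ j ≤ n`). -/
def e (n j : ℕ) : V n := WithLp.toLp 2 fun c : Fin n => if (c : ℕ) + 1 = j then 1 else 0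

/-- The root system of type `B_n`: the vectors `± e_j`, and `± e_j ± e_k` for `j ≠ k`. -/
def roots (n : ℕ) : Set (V n) :=
  {v | (∃ j ∈ Finset.Icc 1 n, v = e n j ∨ v = -e n j) ∨
    ∃ j ∈ Finset.Icc 1 n, ∃ k ∈ Finset.Icc 1 n, j ≠ k ∧
      (v = e n j + e n k ∨ v = e n j - e n k ∨ v = -e n j - e n k)}

/-- The simple roots `α_j = e_j - e_{j+1}` for `1 ≤ j < n`, and `α_n = e_n`. -/
def simpleRoot (n j : ℕ) : V n := if j = n then e n n else e n j - e n (j + 1)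

/-- The highest root `θ = e_1 + e_2`. It is long, with `(θ, θ) = 2`, so it equals its coroot. -/
def theta (n : ℕ) : V n := e n 1 + e n 2

/-- The orthogonal reflection in the hyperplane perpendicular to `α`. -/
def refl {n : ℕ} (α : V n) : Aff n := (ℝ ∙ α)ᗮ.reflection.toLinearEquiv.toAffineEquiv

/-- The translation by `v`. -/
def trans {n : ℕ} (v : V n) : Aff n := AffineEquiv.constVAdd ℝ (V n) v

/-- The finite Weyl group `W₀` of type `B_n`. -/
def weylGroup (n : ℕ) : Subgroup (Aff n) := Subgroup.closure (refl '' roots n)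

/-- The lattice `P` of coweights of type `B_n`, that is, the vectors which pair integrally with
every root. -/
def coweightLattice (n : ℕ) : Set (V n) :=
  {v | ∀ α ∈ roots n, ∃ m : ℤ, inner ℝ α v = (m : ℝ)}

/-- The extended affine Weyl group `W₀ ⋉ P` of type `B_n^(1)`, as a group of affine
transformations of `ℝⁿ`. -/
def extAffineWeyl (n : ℕ) : Subgroup (Aff n) :=
  weylGroup n ⊔ Subgroup.closure (trans '' coweightLattice n)

/-- The generators: `s_0 = t_θ r_θ`, and `s_j` is the reflection in `α_j` for `1 ≤ j ≤ n`. -/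
def s (n : ℕ) (j : Fin (n + 1)) : Aff n :=
  if j = 0 then trans (theta n) * refl (theta n) else refl (simpleRoot n j)

/-- The simple affine roots, as affine functions on `ℝⁿ`: `α_0 = 1 - θ` (where `1` stands for `δ`),
and `α_1, …, α_n`. -/
def affineSimpleRoot (n : ℕ) (j : Fin (n + 1)) (x : V n) : ℝ :=
  if j = 0 then 1 - inner ℝ (theta n) x else inner ℝ (simpleRoot n j) x

/-- The group `Λ` of those elements of the extended affine Weyl group which permute the simple
affine roots (so act as automorphisms of the affine Dynkin diagram). -/
def diagramGroup (n : ℕ) : Subgroup (Aff n) where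
  carrier := {w | w ∈ extAffineWeyl n ∧ ∃ σ : Equiv.Perm (Fin (n + 1)),
    ∀ j x, affineSimpleRoot n (σ j) (w x) = affineSimpleRoot n j x}
  one_mem' := ⟨one_mem _, 1, fun _ _ => rfl⟩
  mul_mem' := by
    rintro v w ⟨hv, σ, hσ⟩ ⟨hw, τ, hτ⟩
    refine ⟨mul_mem hv hw, σ * τ, fun j x => ?_⟩
    rw [Equiv.Perm.mul_apply, AffineEquiv.coe_mul, Function.comp_apply, hσ, hτ]
  inv_mem' := by
    rintro w ⟨hw, σ, hσ⟩
    refine ⟨inv_mem hw, σ⁻¹, fun j x => ?_⟩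
    have h := hσ (σ⁻¹ j) (w⁻¹ x)
    have h₁ : σ (σ⁻¹ j) = j := Equiv.apply_symm_apply σ j
    have h₂ : w (w⁻¹ x) = x := AffineEquiv.apply_symm_apply w x
    rw [h₁, h₂] at h
    exact h.symm

/-- The diagram automorphism `π_1`, realised as `x ↦ (1 - x_1, x_2, …, x_n)`. -/
def piOne (n : ℕ) : Aff n := trans (e n 1) * refl (e n 1)

/-- The `i`-th fundamental coweight `e_1 + ⋯ + e_i` of type `B_n`, dual to the simple roots. -/
def fundCoweight (n i : ℕ) : V n := ∑ j ∈ Finset.Icc 1 i, e n j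

/-- The element `ω_i` of the extended affine Weyl group: the translation by the `i`-th fundamental
coweight. -/
def omega (n i : ℕ) : Aff n := trans (fundCoweight n i)

/-- The product `s_{i_1} ⋯ s_{i_r}` of a word in the generators. -/
def wordProd (n : ℕ) (L : List (Fin (n + 1))) : Aff n := (L.map (s n)).prod

/-- The number `r` of simple reflections in a shortest expression `λ s_{i_1} ⋯ s_{i_r}` of `w`
with `λ ∈ Λ`. -/
def length (n : ℕ) (w : Aff n) : ℕ :=
  sInf {r | ∃ l ∈ diagramGroup n, ∃ L : List (Fin (n + 1)), L.length = r ∧ w = l * wordProd n L}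

/-- `l s_{i_1} ⋯ s_{i_r}`, where `L = (i_1, …, i_r)`, is a reduced expression of `w`. -/
def IsReducedExpression (n : ℕ) (w l : Aff n) (L : List (Fin (n + 1))) : Prop :=
  l ∈ diagramGroup n ∧ w = l * wordProd n L ∧ L.length = length n w

/-- The word `[k,l] = (k, k+1, …, l)`. -/
def seg (n k l : ℕ) : List (Fin (n + 1)) :=
  (List.finRange (n + 1)).filter fun j => k ≤ (j : ℕ) ∧ (j : ℕ) ≤ l

/-- The word `s_0 [2,n] [1,n]`. -/
def block (n : ℕ) : List (Fin (n + 1)) := 0 :: (seg n 2 n ++ seg n 1 n)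

/-- The word `[n-i,n-1] [n-i-1,n-2] ⋯ [2,i+1] [1,i]`, which is empty for `i = n`. -/
def tail (n i : ℕ) : List (Fin (n + 1)) :=
  (List.range (n - i)).flatMap fun t => seg n (n - i - t) (n - 1 - t)

/-- The word `[1,n] (s_0 [2,n] [1,n])^((i-1)/2) [n-i,n-1] ⋯ [1,i]`. -/
def oddWord (n i : ℕ) : List (Fin (n + 1)) :=
  seg n 1 n ++ (List.replicate ((i - 1) / 2) (block n)).flatten ++ tail n i

/-- The word `(s_0 [2,n] [1,n])^(i/2) [n-i,n-1] ⋯ [1,i]`. -/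
def evenWord (n i : ℕ) : List (Fin (n + 1)) :=
  (List.replicate (i / 2) (block n)).flatten ++ tail n i

end

/-! ### The objects above are what they are called -/

theorem trans_apply {n : ℕ} (v x : V n) : trans v x = v + x := rfl

theorem refl_apply {n : ℕ} (α x : V n) :
    refl α x = x - (2 * inner ℝ α x / ‖α‖ ^ 2) • α := by
  change (ℝ ∙ α)ᗮ.reflection x = _
  rw [Submodule.reflection_orthogonal_apply, Submodule.reflection_singleton_apply]
  simp only [RCLike.ofReal_real_eq_id, id_eq, neg_sub]
  rw [mul_div_assoc, mul_smul, ← Nat.cast_smul_eq_nsmul ℝ 2]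
  norm_num

theorem inner_e (n j k : ℕ) (hj : j ∈ Finset.Icc 1 n) :
    inner ℝ (e n j) (e n k) = if j = k then (1 : ℝ) else 0 := by
  rw [Finset.mem_Icc] at hj
  have h : ∀ c : Fin n, ((c : ℕ) + 1 = j ↔ c = ⟨j - 1, by omega⟩) := by
    intro c
    rw [Fin.ext_iff]
    constructor <;> intro h <;> simp only at * <;> omega
  simp only [e, PiLp.inner_apply, h]
  simp
  congr 1
  apply propext
  omega

theorem norm_e (n j : ℕ) (hj : j ∈ Finset.Icc 1 n) : ‖e n j‖ ^ 2 = 1 := by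
  rw [← real_inner_self_eq_norm_sq, inner_e n j j hj, if_pos rfl]

theorem simpleRoot_mem (n j : ℕ) (hj : j ∈ Finset.Icc 1 n) : simpleRoot n j ∈ roots n := by
  unfold simpleRoot
  rw [Finset.mem_Icc] at hj
  split_ifs with h
  · exact Or.inl ⟨n, Finset.mem_Icc.2 (by omega), Or.inl rfl⟩
  · exact Or.inr ⟨j, Finset.mem_Icc.2 (by omega), j + 1, Finset.mem_Icc.2 (by omega), by omega,
      Or.inr (Or.inl rfl)⟩

theorem theta_mem (n : ℕ) (hn : 2 ≤ n) : theta n ∈ roots n :=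
  Or.inr ⟨1, Finset.mem_Icc.2 (by omega), 2, Finset.mem_Icc.2 (by omega), by omega, Or.inl rfl⟩

/-- `θ = α_1 + 2 (α_2 + ⋯ + α_n)`. -/
theorem theta_eq (n : ℕ) (hn : 2 ≤ n) :
    theta n = simpleRoot n 1 + (2 : ℝ) • ∑ j ∈ Finset.Icc 2 n, simpleRoot n j := by
  have key : ∀ d k : ℕ, k + d = n → ∑ j ∈ Finset.Icc k n, simpleRoot n j = e n k := by
    intro d
    induction d with
    | zero => intro k hk; obtain rfl : k = n := hk; simp [simpleRoot]
    | succ d ih =>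
      intro k hk
      rw [← Finset.add_sum_Ioc_eq_sum_Icc (by omega : k ≤ n), ← Finset.Icc_succ_left_eq_Ioc]
      have := ih (k + 1) (by omega)
      simp only [Order.succ_eq_add_one]
      rw [this, simpleRoot, if_neg (by omega)]
      abel
  rw [key (n - 2) 2 (by omega), simpleRoot, if_neg (by omega), theta, two_smul]
  abel

theorem inner_e_fundCoweight (n i j : ℕ) (hj : j ∈ Finset.Icc 1 n) :
    inner ℝ (e n j) (fundCoweight n i) = if j ≤ i then (1 : ℝ) else 0 := by
  rw [fundCoweight, inner_sum, Finset.sum_congr rfl fun k _ => inner_e n j k hj]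
  rw [Finset.mem_Icc] at hj
  simp [hj.1]

/-- The fundamental coweights are dual to the simple roots. -/
theorem inner_simpleRoot_fundCoweight (n i j : ℕ) (hi : i ∈ Finset.Icc 1 n)
    (hj : j ∈ Finset.Icc 1 n) :
    inner ℝ (simpleRoot n j) (fundCoweight n i) = if j = i then (1 : ℝ) else 0 := by
  have hj' := Finset.mem_Icc.1 hj
  have hi' := Finset.mem_Icc.1 hi
  unfold simpleRoot
  split_ifs with h h' h'
  · rw [inner_e_fundCoweight n i n (h ▸ hj), if_pos (by omega)]
  · rw [inner_e_fundCoweight n i n (h ▸ hj), if_neg (by omega)]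
  · rw [inner_sub_left, inner_e_fundCoweight n i j hj,
      inner_e_fundCoweight n i (j + 1) (Finset.mem_Icc.2 (by omega)),
      if_pos (by omega), if_neg (by omega), sub_zero]
  · rw [inner_sub_left, inner_e_fundCoweight n i j hj,
      inner_e_fundCoweight n i (j + 1) (Finset.mem_Icc.2 (by omega))]
    by_cases h2 : j ≤ i
    · rw [if_pos h2, if_pos (by omega), sub_self]
    · rw [if_neg h2, if_neg (by omega), sub_self]

theorem fundCoweight_mem (n i : ℕ) : fundCoweight n i ∈ coweightLattice n := by
  have h : ∀ j ∈ Finset.Icc 1 n, ∃ m : ℤ, inner ℝ (e n j) (fundCoweight n i) = (m : ℝ) := by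
    intro j hj
    exact ⟨if j ≤ i then 1 else 0, by rw [inner_e_fundCoweight n i j hj]; split_ifs <;> simp⟩
  rintro α (⟨j, hj, rfl | rfl⟩ | ⟨j, hj, k, hk, -, rfl | rfl | rfl⟩)
  · exact h j hj
  · obtain ⟨m, hm⟩ := h j hj
    exact ⟨-m, by rw [inner_neg_left, hm]; push_cast; rfl⟩
  all_goals
    obtain ⟨m, hm⟩ := h j hj
    obtain ⟨p, hp⟩ := h k hk
  · exact ⟨m + p, by rw [inner_add_left, hm, hp]; push_cast; rfl⟩
  · exact ⟨m - p, by rw [inner_sub_left, hm, hp]; push_cast; rfl⟩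
  · exact ⟨-m - p, by rw [inner_sub_left, inner_neg_left, hm, hp]; push_cast; rfl⟩

theorem refl_mem {n : ℕ} {α : V n} (h : α ∈ roots n) : refl α ∈ extAffineWeyl n :=
  Subgroup.mem_sup_left (Subgroup.subset_closure ⟨α, h, rfl⟩)

theorem trans_mem {n : ℕ} {v : V n} (h : v ∈ coweightLattice n) : trans v ∈ extAffineWeyl n :=
  Subgroup.mem_sup_right (Subgroup.subset_closure ⟨v, h, rfl⟩)

theorem omega_mem (n i : ℕ) : omega n i ∈ extAffineWeyl n := trans_mem (fundCoweight_mem n i)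

theorem theta_eq_fundCoweight (n : ℕ) : theta n = fundCoweight n 2 := by
  simp [theta, fundCoweight, Finset.sum_Icc_succ_top]

theorem e_one_eq_fundCoweight (n : ℕ) : e n 1 = fundCoweight n 1 := by
  simp [fundCoweight]

theorem s_mem (n : ℕ) (hn : 2 ≤ n) (j : Fin (n + 1)) : s n j ∈ extAffineWeyl n := by
  unfold s
  split_ifs with h
  · refine mul_mem ?_ (refl_mem (theta_mem n hn))
    rw [theta_eq_fundCoweight]
    exact omega_mem n 2
  · have : (j : ℕ) ≠ 0 := fun h' => h (Fin.ext h')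
    exact refl_mem (simpleRoot_mem n j (Finset.mem_Icc.2 ⟨by omega, by omega⟩))

/-- `π_1` interchanges `α_0` and `α_1`, and fixes the other simple affine roots. -/
theorem affineSimpleRoot_piOne (n : ℕ) (hn : 2 ≤ n) (j : Fin (n + 1)) (x : V n) :
    affineSimpleRoot n (Equiv.swap 0 ⟨1, by omega⟩ j) (piOne n x) = affineSimpleRoot n j x := by
  have h1 : (1 : ℕ) ∈ Finset.Icc 1 n := Finset.mem_Icc.2 (by omega)
  have hp : piOne n x = e n 1 + (x - (2 * inner ℝ (e n 1) x) • e n 1) := by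
    rw [piOne, AffineEquiv.coe_mul, Function.comp_apply, trans_apply, refl_apply, norm_e n 1 h1,
      div_one]
  have he : ∀ k ∈ Finset.Icc 1 n, inner ℝ (e n k) (piOne n x) =
      if k = 1 then 1 - inner ℝ (e n 1) x else inner ℝ (e n k) x := by
    intro k hk
    rw [hp, inner_add_right, inner_sub_right, inner_smul_right, inner_e n k 1 hk]
    split_ifs with h
    · subst h; ring
    · ring
  have h1' := he 1 h1
  have h2' := he 2 (Finset.mem_Icc.2 (by omega))
  norm_num at h1' h2'
  have hne : (⟨1, by omega⟩ : Fin (n + 1)) ≠ 0 := by simp [Fin.ext_iff]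
  by_cases hj0 : j = 0
  · subst hj0
    rw [Equiv.swap_apply_left]
    simp only [affineSimpleRoot, if_neg hne, if_true, simpleRoot, theta]
    rw [if_neg (by omega), inner_sub_left, inner_add_left]
    norm_num
    rw [h1', h2']
    ring
  by_cases hj1 : j = ⟨1, by omega⟩
  · subst hj1
    rw [Equiv.swap_apply_right]
    simp only [affineSimpleRoot, if_neg hne, if_true, simpleRoot, theta]
    rw [if_neg (by omega), inner_sub_left, inner_add_left]
    norm_num
    rw [h1', h2']
    ring
  · rw [Equiv.swap_apply_of_ne_of_ne hj0 hj1]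
    have ha : (j : ℕ) ≠ 0 := fun h' => hj0 (Fin.ext h')
    have hb : (j : ℕ) ≠ 1 := fun h' => hj1 (Fin.ext h')
    simp only [affineSimpleRoot, if_neg hj0, simpleRoot]
    split_ifs with h
    · rw [he n (Finset.mem_Icc.2 (by omega)), if_neg (by omega)]
    · rw [inner_sub_left, inner_sub_left, he j (Finset.mem_Icc.2 (by omega)),
        he (j + 1) (Finset.mem_Icc.2 (by omega)), if_neg (by omega), if_neg (by omega)]

theorem piOne_mem (n : ℕ) (hn : 2 ≤ n) : piOne n ∈ diagramGroup n := by
  refine ⟨mul_mem ?_ (refl_mem ?_), _, affineSimpleRoot_piOne n hn⟩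
  · rw [e_one_eq_fundCoweight]
    exact omega_mem n 1
  · exact Or.inl ⟨1, Finset.mem_Icc.2 (by omega), Or.inl rfl⟩

end AffineB

/-! Both claims are read off from the action on coordinates. The word [k,l] with l < n shifts the
coordinates k, …, l+1 cyclically, and [k,n] shifts k, …, n cyclically with one sign change. In
s_0[2,n][1,n] the signs cancel, and x goes to (1+x_{n-1}, 1+x_n, x_1, …, x_{n-2}). The tail sends x
to (x_{i+1}, …, x_n, x_1, …, x_i), so the powers of the block put x_1, …, x_i back in front, two at
a time, each raised by 1. For odd i, the coordinate left over is treated by π_1[1,n] (`omega_even`,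
`omega_odd`).

The words have i(2n-i) letters, and hyperplane counting shows that none is shorter. `sepDist` counts
each separating affine root hyperplane four times: a long root is a sum of two vectors ±e_j in two
orders, short roots get the weight 2 to match, and opposite roots have the same hyperplanes. It
satisfies the triangle inequality and is invariant under the extended group (`sepDist_invariant`).
On the fundamental alcove a generator crosses only its own wall (`sepDist_s`), and Λ crosses none,
so an expression with r letters moves an alcove point by at most 4r (`sepDist_mul_wordProd`). The
translation ω_i moves every point by exactly 4i(2n-i) (`sepDist_omega`). -/

namespace AffineB

/-! ### Coordinates and explicit reflections -/

/-- The `m`-th coordinate of a vector, numbered from `1`. -/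
noncomputable def co {n : ℕ} (x : V n) (m : ℕ) : ℝ := inner ℝ (e n m) x

theorem co_eq {n : ℕ} (x : V n) (c : Fin n) : co x (c + 1) = x c := by
  simp only [co, e, PiLp.inner_apply, add_left_inj, ← Fin.ext_iff]
  simp

theorem ext_co {n : ℕ} {x y : V n} (h : ∀ m, 1 ≤ m → m ≤ n → co x m = co y m) : x = y := by
  ext c
  rw [← co_eq, ← co_eq]
  exact h _ (by omega) (by omega)

theorem ext_aff {n : ℕ} {g h : Aff n}
    (H : ∀ x m, 1 ≤ m → m ≤ n → co (g x) m = co (h x) m) : g = h :=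
  AffineEquiv.ext fun x => ext_co (H x)

theorem co_add {n : ℕ} (x y : V n) (m : ℕ) : co (x + y) m = co x m + co y m :=
  inner_add_right ..

theorem co_sub {n : ℕ} (x y : V n) (m : ℕ) : co (x - y) m = co x m - co y m :=
  inner_sub_right ..

theorem co_smul {n : ℕ} (a : ℝ) (x : V n) (m : ℕ) : co (a • x) m = a * co x m :=
  inner_smul_right ..

theorem co_e {n m : ℕ} (h1 : 1 ≤ m) (hm : m ≤ n) (k : ℕ) :
    co (e n k) m = if m = k then 1 else 0 :=
  inner_e n m k (Finset.mem_Icc.2 ⟨h1, hm⟩)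

theorem co_fundCoweight {n m : ℕ} (h1 : 1 ≤ m) (hm : m ≤ n) (i : ℕ) :
    co (fundCoweight n i) m = if m ≤ i then 1 else 0 :=
  inner_e_fundCoweight n i m (Finset.mem_Icc.2 ⟨h1, hm⟩)

theorem norm_sq_sub {n j k : ℕ} (hj : j ∈ Finset.Icc 1 n) (hk : k ∈ Finset.Icc 1 n)
    (hjk : j ≠ k) : ‖e n j - e n k‖ ^ 2 = 2 := by
  rw [norm_sub_sq_real, norm_e n j hj, norm_e n k hk, inner_e n j k hj, if_neg hjk]
  norm_num

theorem norm_sq_add {n j k : ℕ} (hj : j ∈ Finset.Icc 1 n) (hk : k ∈ Finset.Icc 1 n)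
    (hjk : j ≠ k) : ‖e n j + e n k‖ ^ 2 = 2 := by
  rw [norm_add_sq_real, norm_e n j hj, norm_e n k hk, inner_e n j k hj, if_neg hjk]
  norm_num

theorem refl_e {n j : ℕ} (hj : j ∈ Finset.Icc 1 n) (x : V n) :
    refl (e n j) x = x - (2 * co x j) • e n j := by
  rw [refl_apply, norm_e n j hj, div_one, co]

theorem refl_sub {n j k : ℕ} (hj : j ∈ Finset.Icc 1 n) (hk : k ∈ Finset.Icc 1 n)
    (hjk : j ≠ k) (x : V n) :
    refl (e n j - e n k) x = x - (co x j - co x k) • (e n j - e n k) := by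
  rw [refl_apply, norm_sq_sub hj hk hjk, inner_sub_left, co, co]
  congr 2
  ring

theorem refl_add {n j k : ℕ} (hj : j ∈ Finset.Icc 1 n) (hk : k ∈ Finset.Icc 1 n)
    (hjk : j ≠ k) (x : V n) :
    refl (e n j + e n k) x = x - (co x j + co x k) • (e n j + e n k) := by
  rw [refl_apply, norm_sq_add hj hk hjk, inner_add_left, co, co]
  congr 2
  ring

theorem co_trans {n : ℕ} (v x : V n) (m : ℕ) : co (trans v x) m = co v m + co x m := by
  rw [trans_apply, co_add]

/-! ### Action of the generators on coordinates -/

section Generators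

variable {n m : ℕ}

theorem co_s_lt (j : Fin (n + 1)) (h1 : 1 ≤ m) (hm : m ≤ n) (hj : 1 ≤ (j : ℕ))
    (hj' : (j : ℕ) < n) (x : V n) : co (s n j x) m =
      if m = j then co x (j + 1) else if m = j + 1 then co x j else co x m := by
  have hj0 : j ≠ 0 := fun h => by simp [h] at hj
  rw [s, if_neg hj0, simpleRoot, if_neg hj'.ne, refl_sub (by simp; omega) (by simp; omega)
    (by omega), co_sub, co_smul, co_sub, co_e h1 hm, co_e h1 hm]
  split_ifs with h h' h'
  · omega
  · rw [h]; ring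
  · rw [h']; ring
  · ring

theorem co_s_last (j : Fin (n + 1)) (h1 : 1 ≤ m) (hm : m ≤ n) (hj' : (j : ℕ) = n) (x : V n) :
    co (s n j x) m = if m = n then -co x n else co x m := by
  have hj0 : j ≠ 0 := fun h => by simp [h] at hj'; omega
  rw [s, if_neg hj0, simpleRoot, if_pos hj', refl_e (by simp; omega), co_sub, co_smul, co_e h1 hm]
  split_ifs with h
  · rw [h]; ring
  · ring

theorem co_s_zero (hn : 2 ≤ n) (h1 : 1 ≤ m) (hm : m ≤ n) (x : V n) :
    co (s n 0 x) m = if m = 1 then 1 - co x 2 else if m = 2 then 1 - co x 1 else co x m := by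
  rw [s, if_pos rfl, AffineEquiv.coe_mul, Function.comp_apply, co_trans, theta,
    refl_add (by simp; omega) (by simp; omega) (by omega), co_sub, co_smul, co_add, co_e h1 hm,
    co_e h1 hm]
  split_ifs with h h' h'
  · omega
  · rw [h]; ring
  · rw [h']; ring
  · ring

theorem co_piOne (h1 : 1 ≤ m) (hm : m ≤ n) (x : V n) :
    co (piOne n x) m = if m = 1 then 1 - co x 1 else co x m := by
  rw [piOne, AffineEquiv.coe_mul, Function.comp_apply, co_trans, refl_e (by simp; omega), co_sub,
    co_smul, co_e h1 hm]
  split_ifs with h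
  · rw [h]; ring
  · ring

theorem co_omega (h1 : 1 ≤ m) (hm : m ≤ n) (i : ℕ) (x : V n) :
    co (omega n i x) m = (if m ≤ i then 1 else 0) + co x m := by
  rw [omega, co_trans, co_fundCoweight h1 hm]

end Generators

/-! ### Action of the words on coordinates -/

theorem seg_cons {n k l : ℕ} (hk : k ≤ l) (hl : l ≤ n) :
    seg n k l = ⟨k, by omega⟩ :: seg n (k + 1) l := by
  have hs : ∀ a b, (seg n a b).Pairwise (· < ·) := fun a b =>
    (List.pairwise_lt_finRange (n + 1)).filter _
  have hc : ((⟨k, by omega⟩ : Fin (n + 1)) :: seg n (k + 1) l).Pairwise (· < ·) := by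
    refine List.pairwise_cons.2 ⟨fun a ha => ?_, hs _ _⟩
    simp only [seg, List.mem_filter, decide_eq_true_eq] at ha
    exact Fin.lt_def.2 (by simp only; omega)
  -- A strictly increasing list is determined by its set of members.
  refine List.Perm.eq_of_pairwise (le := (· < ·)) (fun a b _ _ h h' => absurd h h'.asymm)
    (hs k l) hc ?_
  refine (List.perm_ext_iff_of_nodup ((hs k l).imp fun h => h.ne) (hc.imp fun h => h.ne)).2 ?_
  intro a
  simp only [seg, List.mem_filter, List.mem_finRange, true_and, decide_eq_true_eq, List.mem_cons,
    Fin.ext_iff]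
  omega

theorem seg_nil {n k l : ℕ} (h : l < k) : seg n k l = [] := by
  refine List.filter_eq_nil_iff.2 fun a _ => ?_
  simp only [decide_eq_true_eq]
  omega

theorem length_seg {n l : ℕ} (hl : l ≤ n) (k : ℕ) : (seg n k l).length = l + 1 - k := by
  induction d : l + 1 - k generalizing k with
  | zero => rw [seg_nil (by omega)]; rfl
  | succ d ih => rw [seg_cons (by omega) hl, List.length_cons, ih (k + 1) (by omega)]

theorem wordProd_nil (n : ℕ) : wordProd n [] = 1 := rfl

theorem wordProd_cons (n : ℕ) (j : Fin (n + 1)) (L : List (Fin (n + 1))) :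
    wordProd n (j :: L) = s n j * wordProd n L := by
  simp [wordProd]

theorem wordProd_append (n : ℕ) (L M : List (Fin (n + 1))) :
    wordProd n (L ++ M) = wordProd n L * wordProd n M := by
  simp [wordProd]

theorem mul_apply {n : ℕ} (g h : Aff n) (x : V n) : (g * h) x = g (h x) := rfl

theorem one_apply {n : ℕ} (x : V n) : (1 : Aff n) x = x := rfl

theorem wordProd_seg_cons {n k l : ℕ} (hk : k ≤ l) (hl : l ≤ n) :
    wordProd n (seg n k l) = s n ⟨k, by omega⟩ * wordProd n (seg n (k + 1) l) := by
  rw [seg_cons hk hl, wordProd_cons]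

/-- The rightmost letter acts first, so the entry at l+1 is carried down to position k and the
others move up by one. The empty word k = l+1 is admitted as the base of the induction. -/
theorem co_seg_lt {n k l m : ℕ} (hk : 1 ≤ k) (hkl : k ≤ l + 1) (hl : l < n) (h1 : 1 ≤ m)
    (hm : m ≤ n) (x : V n) : co (wordProd n (seg n k l) x) m =
      if m = k then co x (l + 1) else if k < m ∧ m ≤ l + 1 then co x (m - 1) else co x m := by
  induction d : l + 1 - k generalizing k m with
  | zero =>
    rw [seg_nil (by omega), wordProd_nil, one_apply]
    split_ifs
    · congr 1; omega
    · omega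
    · rfl
  | succ d ih =>
    rw [wordProd_seg_cons (by omega) hl.le, mul_apply, co_s_lt _ h1 hm hk (by simp only; omega)]
    simp only
    split_ifs with h h' h'
    · rw [ih (by omega) (by omega) (by omega) (by omega) (by omega), if_pos rfl]
    · rw [ih (by omega) (by omega) (by omega) (by omega) (by omega), if_neg (by omega),
        if_neg (by omega)]
      congr 1; omega
    · omega
    · rw [ih (by omega) (by omega) h1 hm (by omega), if_neg h', if_pos (by omega)]
    · rw [ih (by omega) (by omega) h1 hm (by omega), if_neg h', if_neg (by omega)]

/-- Here s_n acts first and negates the last entry, which is then carried down to position k. -/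
theorem co_seg_last {n k m : ℕ} (hk : 1 ≤ k) (hkn : k ≤ n) (h1 : 1 ≤ m)
    (hm : m ≤ n) (x : V n) : co (wordProd n (seg n k n) x) m =
      if m = k then -co x n else if k < m then co x (m - 1) else co x m := by
  induction d : n - k generalizing k m with
  | zero =>
    rw [wordProd_seg_cons hkn le_rfl, seg_nil (by omega), wordProd_nil, mul_apply, one_apply,
      co_s_last _ h1 hm (by simp only; omega)]
    split_ifs
    all_goals first | rfl | omega
  | succ d ih =>
    rw [wordProd_seg_cons (by omega) le_rfl, mul_apply, co_s_lt _ h1 hm hk (by simp only; omega)]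
    simp only
    split_ifs with h h' h'
    · rw [ih (by omega) (by omega) (by omega) (by omega) (by omega), if_pos rfl]
    · rw [ih (by omega) (by omega) (by omega) (by omega) (by omega), if_neg (by omega),
        if_neg (by omega)]
      congr 1; omega
    · omega
    · rw [ih (by omega) (by omega) h1 hm (by omega), if_neg h', if_pos (by omega)]
    · rw [ih (by omega) (by omega) h1 hm (by omega), if_neg h', if_neg (by omega)]

theorem wordProd_block (n : ℕ) :
    wordProd n (block n) = s n 0 * wordProd n (seg n 2 n) * wordProd n (seg n 1 n) := by
  rw [block, wordProd_cons, wordProd_append, mul_assoc]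

/-- The product [2,n][1,n] puts -x_n, -x_{n-1} in front; s_0 exchanges these two and replaces each
by 1 minus itself, which cancels the signs. -/
theorem co_block {n m : ℕ} (hn : 2 ≤ n) (h1 : 1 ≤ m) (hm : m ≤ n) (x : V n) :
    co (wordProd n (block n) x) m =
      if m ≤ 2 then 1 + co x (n - 2 + m) else co x (m - 2) := by
  have key : ∀ m, 1 ≤ m → m ≤ n →
      co (wordProd n (seg n 2 n) (wordProd n (seg n 1 n) x)) m =
        if m = 1 then -co x n else if m = 2 then -co x (n - 1) else co x (m - 2) := by
    intro m h1 hm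
    rw [co_seg_last (by omega) hn h1 hm]
    split_ifs
    · omega
    · rw [co_seg_last le_rfl (by omega) (by omega) le_rfl, if_neg (by omega), if_pos (by omega)]
    · omega
    · rw [co_seg_last le_rfl (by omega) (by omega) (by omega), if_neg (by omega),
        if_pos (by omega)]
      congr 1
    · rw [co_seg_last le_rfl (by omega) h1 hm, if_pos (by omega)]
    · omega
  rw [wordProd_block, mul_apply, mul_apply, co_s_zero hn h1 hm]
  split_ifs with h h' h' h''
  · rw [key 2 (by omega) hn, if_neg (by omega), if_pos rfl, sub_neg_eq_add]
    congr 2; omega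
  · omega
  · rw [key 1 (by omega) (by omega), if_pos rfl, sub_neg_eq_add]
    congr 2; omega
  · omega
  · omega
  · rw [key m h1 hm, if_neg h, if_neg h']

/-- The bound 2k ≤ n ensures that no coordinate is raised twice. -/
theorem co_block_pow {n m : ℕ} (hn : 2 ≤ n) (k : ℕ) (hk : 2 * k ≤ n) (h1 : 1 ≤ m) (hm : m ≤ n)
    (x : V n) : co ((wordProd n (block n) ^ k) x) m =
      if m ≤ 2 * k then 1 + co x (n - 2 * k + m) else co x (m - 2 * k) := by
  induction k generalizing m with
  | zero => rw [pow_zero, one_apply, if_neg (by omega)]; rfl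
  | succ k ih =>
    rw [pow_succ', mul_apply, co_block hn h1 hm]
    split_ifs
    · rw [ih (by omega) (by omega) (by omega), if_neg (by omega)]
      congr 2; omega
    · omega
    · rw [ih (by omega) (by omega) (by omega), if_pos (by omega)]
      congr 2; omega
    · rw [ih (by omega) (by omega) (by omega), if_neg (by omega)]
      congr 1; omega

/-- The word `[r,r+i-1] ⋯ [2,i+1] [1,i]`. -/
def segs (n i : ℕ) : ℕ → List (Fin (n + 1))
  | 0 => []
  | r + 1 => seg n (r + 1) (r + i) ++ segs n i r

theorem tail_eq_segs {n i : ℕ} (hin : i ≤ n) : tail n i = segs n i (n - i) := by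
  -- The endpoints of the segments are written with i + r in place of n, so that r can vary while
  -- the rank n stays fixed.
  have key : ∀ r, i + r ≤ n → ((List.range r).flatMap fun t => seg n (r - t) (i + r - 1 - t)) =
      segs n i r := by
    intro r
    induction r with
    | zero => intro _; rfl
    | succ r ih =>
      intro h
      rw [List.range_succ_eq_map, List.flatMap_cons, List.flatMap_map, segs, ← ih (by omega)]
      congr 2
      · omega
      · funext t
        simp only [Nat.succ_eq_add_one]
        congr 1 <;> omega
  rw [← key (n - i) (by omega), tail]
  congr 1
  funext t
  congr 2
  omega

/-- Each further segment carries one more entry leftwards past the window x_1, …, x_i, which moves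
one place to the right. -/
theorem co_segs {n i m : ℕ} (hi : 1 ≤ i) (r : ℕ) (hr : i + r ≤ n) (h1 : 1 ≤ m) (hm : m ≤ n)
    (x : V n) : co (wordProd n (segs n i r) x) m =
      if m ≤ r then co x (i + m) else if m ≤ i + r then co x (m - r) else co x m := by
  induction r generalizing m with
  | zero =>
    rw [segs, wordProd_nil, one_apply]
    split_ifs
    · omega
    · rfl
    · rfl
  | succ r ih =>
    rw [segs, wordProd_append, mul_apply, co_seg_lt (by omega) (by omega) (by omega) h1 hm]
    split_ifs with h h' h' h'' h''
    · rw [ih (by omega) (by omega) (by omega), if_neg (by omega), if_neg (by omega)]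
      congr 1; omega
    · omega
    · omega
    · omega
    · rw [ih (by omega) (by omega) (by omega), if_neg (by omega), if_pos (by omega)]
      congr 1; omega
    · omega
    · rw [ih (by omega) (by omega) (by omega), if_pos (by omega)]
    · omega
    · rw [ih (by omega) (by omega) (by omega), if_neg (by omega), if_neg (by omega)]

theorem co_tail {n i m : ℕ} (hi : 1 ≤ i) (hin : i ≤ n) (h1 : 1 ≤ m) (hm : m ≤ n) (x : V n) :
    co (wordProd n (tail n i) x) m =
      if m ≤ n - i then co x (i + m) else co x (m - (n - i)) := by
  rw [tail_eq_segs hin, co_segs hi _ (by omega) h1 hm]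
  simp only [show m ≤ i + (n - i) by omega, if_true]

/-! ### Word lengths and the factorizations of ω_i -/

theorem length_segs {n i : ℕ} (r : ℕ) (hr : i + r ≤ n) : (segs n i r).length = r * i := by
  induction r with
  | zero => simp [segs]
  | succ r ih =>
    rw [segs, List.length_append, ih (by omega), length_seg (by omega), Nat.succ_mul]
    omega

theorem length_block {n : ℕ} (hn : 2 ≤ n) : (block n).length = 2 * n := by
  rw [block, List.length_cons, List.length_append, length_seg le_rfl, length_seg le_rfl]
  omega

theorem length_blocks {n : ℕ} (hn : 2 ≤ n) (k : ℕ) :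
    (List.replicate k (block n)).flatten.length = k * (2 * n) := by
  simp [length_block hn]

theorem wordProd_blocks (n k : ℕ) :
    wordProd n (List.replicate k (block n)).flatten = wordProd n (block n) ^ k := by
  induction k with
  | zero => simp [wordProd_nil]
  | succ k ih => rw [List.replicate_succ, List.flatten_cons, wordProd_append, ih, pow_succ']

theorem omega_even {n i : ℕ} (hn : 2 ≤ n) (hi : 1 ≤ i) (hin : i ≤ n) (h : Even i) :
    omega n i = wordProd n (block n) ^ (i / 2) * wordProd n (tail n i) := by
  obtain ⟨k, rfl⟩ := h
  refine ext_aff fun x m h1 hm => ?_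
  rw [mul_apply, show (k + k) / 2 = k by omega, co_block_pow hn k (by omega) h1 hm, co_omega h1 hm]
  split_ifs
  · rw [co_tail hi hin (by omega) (by omega), if_neg (by omega)]
    congr 2; omega
  · omega
  · omega
  · rw [co_tail hi hin (by omega) (by omega), if_pos (by omega), zero_add]
    congr 1; omega

theorem omega_odd {n i : ℕ} (hn : 2 ≤ n) (hi : 1 ≤ i) (hin : i ≤ n) (h : Odd i) :
    omega n i = piOne n * wordProd n (seg n 1 n) * wordProd n (block n) ^ ((i - 1) / 2) *
      wordProd n (tail n i) := by
  obtain ⟨k, rfl⟩ := h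
  refine ext_aff fun x m h1 hm => ?_
  -- The blocks and the tail give (1+x_2, …, 1+x_i, x_{i+1}, …, x_n, x_1). Then [1,n] brings -x_1 to
  -- the front, and π_1 turns it into 1+x_1.
  have key : ∀ m, 1 ≤ m → m ≤ n → co (wordProd n (block n) ^ k <| wordProd n (tail n (2 * k + 1)) x)
      m = if m ≤ 2 * k then 1 + co x (m + 1) else if m < n then co x (m + 1) else co x 1 := by
    intro m h1 hm
    rw [co_block_pow hn k (by omega) h1 hm]
    split_ifs
    · rw [co_tail hi hin (by omega) (by omega), if_neg (by omega)]
      congr 2; omega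
    · rw [co_tail hi hin (by omega) (by omega), if_pos (by omega)]
      congr 1; omega
    · rw [co_tail hi hin (by omega) (by omega), if_neg (by omega)]
      congr 1; omega
  rw [mul_apply, mul_apply, mul_apply, show (2 * k + 1 - 1) / 2 = k by omega, co_piOne h1 hm,
    co_omega h1 hm]
  split_ifs with h2 h3 h3
  · rw [co_seg_last le_rfl (by omega) le_rfl (by omega), if_pos rfl, key n (by omega) le_rfl,
      if_neg (by omega), if_neg (by omega), h3, sub_neg_eq_add]
  · rw [co_seg_last le_rfl (by omega) h1 hm, if_neg h3, if_pos (by omega),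
      key _ (by omega) (by omega), if_pos (by omega)]
    congr 2; omega
  · omega
  · rw [co_seg_last le_rfl (by omega) h1 hm, if_neg h3, if_pos (by omega),
      key _ (by omega) (by omega), if_neg (by omega), if_pos (by omega), zero_add]
    congr 1; omega

theorem wordProd_evenWord (n i : ℕ) :
    wordProd n (evenWord n i) = wordProd n (block n) ^ (i / 2) * wordProd n (tail n i) := by
  rw [evenWord, wordProd_append, wordProd_blocks]

theorem wordProd_oddWord (n i : ℕ) :
    wordProd n (oddWord n i) = wordProd n (seg n 1 n) * wordProd n (block n) ^ ((i - 1) / 2) *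
      wordProd n (tail n i) := by
  rw [oddWord, wordProd_append, wordProd_append, wordProd_blocks]

theorem length_evenWord {n i : ℕ} (hn : 2 ≤ n) (hin : i ≤ n) (h : Even i) :
    (evenWord n i).length = i * (2 * n - i) := by
  rw [evenWord, List.length_append, length_blocks hn, tail_eq_segs hin, length_segs _ (by omega)]
  obtain ⟨k, rfl⟩ := h
  obtain ⟨d, rfl⟩ := Nat.exists_eq_add_of_le hin
  rw [show (k + k) / 2 = k by omega, show k + k + d - (k + k) = d by omega,
    show 2 * (k + k + d) - (k + k) = k + k + 2 * d by omega]
  ring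

theorem length_oddWord {n i : ℕ} (hn : 2 ≤ n) (hin : i ≤ n) (h : Odd i) :
    (oddWord n i).length = i * (2 * n - i) := by
  rw [oddWord, List.length_append, List.length_append, length_blocks hn, length_seg le_rfl,
    tail_eq_segs hin, length_segs _ (by omega)]
  obtain ⟨k, rfl⟩ := h
  obtain ⟨d, rfl⟩ := Nat.exists_eq_add_of_le hin
  rw [show (2 * k + 1 - 1) / 2 = k by omega, show 2 * k + 1 + d - (2 * k + 1) = d by omega,
    show 2 * (2 * k + 1 + d) - (2 * k + 1) = 2 * k + 1 + 2 * d by omega, Nat.add_sub_cancel]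
  ring

/-! ### Counting separating hyperplanes -/

/-- The number of integers that separate `a` and `b`. -/
noncomputable def floorDist (a b : ℝ) : ℤ := |⌊a⌋ - ⌊b⌋|

theorem floorDist_self (a : ℝ) : floorDist a a = 0 := by simp [floorDist]

theorem floorDist_triangle (a b c : ℝ) : floorDist a c ≤ floorDist a b + floorDist b c :=
  abs_sub_le _ _ _

theorem floorDist_add_intCast (a b : ℝ) (k : ℤ) :
    floorDist (k + a) (k + b) = floorDist a b := by
  simp [floorDist, Int.floor_intCast_add]

/-- Exact for every real a, so displacements by translations need no genericity. -/
theorem floorDist_intCast_add (a : ℝ) (k : ℤ) : floorDist a (k + a) = |k| := by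
  rw [floorDist, Int.floor_intCast_add, sub_add_cancel_right, abs_neg]

theorem floorDist_eq_zero {a b : ℝ} (k : ℤ) (ha : k ≤ a) (ha' : a < k + 1) (hb : k ≤ b)
    (hb' : b < k + 1) : floorDist a b = 0 := by
  rw [floorDist, Int.floor_eq_iff.2 ⟨ha, ha'⟩, Int.floor_eq_iff.2 ⟨hb, hb'⟩, sub_self, abs_zero]

/-- Only the integer k+1 lies inside the window: at most one hyperplane of the family is crossed. -/
theorem floorDist_le_one {a b : ℝ} (k : ℤ) (ha : k ≤ a) (ha' : a < k + 2) (hb : k ≤ b)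
    (hb' : b < k + 2) : floorDist a b ≤ 1 := by
  have h1 := Int.le_floor.2 ha
  have h2 := Int.le_floor.2 hb
  have h3 : ⌊a⌋ < k + 2 := Int.floor_lt.2 (by push_cast; exact ha')
  have h4 : ⌊b⌋ < k + 2 := Int.floor_lt.2 (by push_cast; exact hb')
  rw [floorDist, abs_le]
  omega

/-- The vectors `± e_j`. -/
noncomputable def signedBasis (n : ℕ) : Finset (V n) :=
  open Classical in
  (Finset.Icc 1 n).image (e n) ∪ (Finset.Icc 1 n).image fun m => -e n m

theorem mem_signedBasis {n : ℕ} {v : V n} :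
    v ∈ signedBasis n ↔ ∃ m ∈ Finset.Icc 1 n, v = e n m ∨ v = -e n m := by
  classical
  simp only [signedBasis, Finset.mem_union, Finset.mem_image]
  constructor
  · rintro (⟨m, hm, rfl⟩ | ⟨m, hm, rfl⟩)
    exacts [⟨m, hm, .inl rfl⟩, ⟨m, hm, .inr rfl⟩]
  · rintro ⟨m, hm, rfl | rfl⟩
    exacts [.inl ⟨m, hm, rfl⟩, .inr ⟨m, hm, rfl⟩]

theorem e_eq_iff {n m k : ℕ} (hm : m ∈ Finset.Icc 1 n) : e n m = e n k ↔ m = k := by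
  refine ⟨fun h => ?_, fun h => h ▸ rfl⟩
  have h' := inner_e n m k hm
  rw [← h, inner_e n m m hm, if_pos rfl] at h'
  by_contra hne
  rw [if_neg hne] at h'
  exact one_ne_zero h'

theorem e_ne_neg {n m : ℕ} (hm : m ∈ Finset.Icc 1 n) (k : ℕ) : e n m ≠ -e n k := by
  intro h
  have h' := inner_e n m m hm
  rw [if_pos rfl] at h'
  nth_rewrite 2 [h] at h'
  rw [inner_neg_right, inner_e n m k hm] at h'
  split_ifs at h' <;> norm_num at h'

theorem sum_signedBasis {n : ℕ} (h : V n → ℤ) :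
    ∑ v ∈ signedBasis n, h v = ∑ m ∈ Finset.Icc 1 n, (h (e n m) + h (-e n m)) := by
  classical
  rw [signedBasis, Finset.sum_union, Finset.sum_image, Finset.sum_image, Finset.sum_add_distrib]
  · intro m hm k _ hmk
    exact (e_eq_iff hm).1 (neg_injective hmk)
  · intro m hm k _ hmk
    exact (e_eq_iff hm).1 hmk
  · rw [Finset.disjoint_left]
    intro v hv hv'
    obtain ⟨m, hm, rfl⟩ := Finset.mem_image.1 hv
    obtain ⟨k, -, hk⟩ := Finset.mem_image.1 hv'
    exact e_ne_neg hm k hk.symm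

theorem refl_neg {n : ℕ} (α x : V n) : refl (-α) x = refl α x := by
  rw [refl_apply, refl_apply, inner_neg_left, norm_neg]
  simp [neg_div]

theorem refl_apply_neg {n : ℕ} (α x : V n) : refl α (-x) = -refl α x :=
  map_neg (ℝ ∙ α)ᗮ.reflection x

theorem refl_apply_add {n : ℕ} (α x y : V n) : refl α (x + y) = refl α x + refl α y :=
  map_add (ℝ ∙ α)ᗮ.reflection x y

theorem refl_refl {n : ℕ} (α x : V n) : refl α (refl α x) = x :=
  Submodule.reflection_reflection _ x

theorem inner_refl {n : ℕ} (α x y : V n) : inner ℝ x (refl α y) = inner ℝ (refl α x) y := by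
  conv_lhs => rw [← refl_refl α x]
  exact (ℝ ∙ α)ᗮ.reflection.inner_map_map (refl α x) y

/-- Reflections in roots are signed permutations of the coordinates. -/
theorem refl_mem_signedBasis {n : ℕ} {α v : V n} (hα : α ∈ roots n) (hv : v ∈ signedBasis n) :
    refl α v ∈ signedBasis n := by
  have main : ∀ m ∈ Finset.Icc 1 n, refl α (e n m) ∈ signedBasis n := by
    intro m hm
    have hm' := Finset.mem_Icc.1 hm
    have short : ∀ j ∈ Finset.Icc 1 n, refl (e n j) (e n m) ∈ signedBasis n := by
      intro j hj
      have hj' := Finset.mem_Icc.1 hj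
      rw [refl_e hj, co_e hj'.1 hj'.2, mem_signedBasis]
      split_ifs with h
      · exact ⟨m, hm, .inr (by rw [h]; module)⟩
      · exact ⟨m, hm, .inl (by module)⟩
    have plus : ∀ j ∈ Finset.Icc 1 n, ∀ k ∈ Finset.Icc 1 n, j ≠ k →
        refl (e n j + e n k) (e n m) ∈ signedBasis n := by
      intro j hj k hk hjk
      have hj' := Finset.mem_Icc.1 hj
      have hk' := Finset.mem_Icc.1 hk
      rw [refl_add hj hk hjk, co_e hj'.1 hj'.2, co_e hk'.1 hk'.2, mem_signedBasis]
      split_ifs with h h' h'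
      · omega
      · exact ⟨k, hk, .inr (by rw [h]; module)⟩
      · exact ⟨j, hj, .inr (by rw [h']; module)⟩
      · exact ⟨m, hm, .inl (by module)⟩
    rcases hα with ⟨j, hj, rfl | rfl⟩ | ⟨j, hj, k, hk, hjk, rfl | rfl | rfl⟩
    · exact short j hj
    · rw [refl_neg]
      exact short j hj
    · exact plus j hj k hk hjk
    · have hj' := Finset.mem_Icc.1 hj
      have hk' := Finset.mem_Icc.1 hk
      rw [refl_sub hj hk hjk, co_e hj'.1 hj'.2, co_e hk'.1 hk'.2, mem_signedBasis]
      split_ifs with h h' h'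
      · omega
      · exact ⟨k, hk, .inl (by rw [h]; module)⟩
      · exact ⟨j, hj, .inl (by rw [h']; module)⟩
      · exact ⟨m, hm, .inl (by module)⟩
    · rw [← neg_add', refl_neg]
      exact plus j hj k hk hjk
  obtain ⟨m, hm, rfl | rfl⟩ := mem_signedBasis.1 hv
  · exact main m hm
  · rw [refl_apply_neg]
    obtain ⟨k, hk, h | h⟩ := mem_signedBasis.1 (main m hm)
    · exact mem_signedBasis.2 ⟨k, hk, .inr (by rw [h])⟩
    · exact mem_signedBasis.2 ⟨k, hk, .inl (by rw [h, neg_neg])⟩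

/-- Four times the number of affine root hyperplanes that separate `x` and `y`. -/
noncomputable def sepDist {n : ℕ} (x y : V n) : ℤ :=
  2 * ∑ v ∈ signedBasis n, floorDist (inner ℝ v x) (inner ℝ v y) +
    ∑ q ∈ (signedBasis n).offDiag,
      floorDist (inner ℝ (q.1 + q.2) x) (inner ℝ (q.1 + q.2) y)

theorem sepDist_triangle {n : ℕ} (x y z : V n) : sepDist x z ≤ sepDist x y + sepDist y z := by
  have h := Finset.sum_le_sum (s := signedBasis n) fun v _ =>
    floorDist_triangle (inner ℝ v x) (inner ℝ v y) (inner ℝ v z)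
  have h' := Finset.sum_le_sum (s := (signedBasis n).offDiag) fun q _ =>
    floorDist_triangle (inner ℝ (q.1 + q.2) x) (inner ℝ (q.1 + q.2) y) (inner ℝ (q.1 + q.2) z)
  rw [Finset.sum_add_distrib] at h h'
  unfold sepDist
  linarith

/-- The reflection is self-adjoint, linear and involutive, so it only reindexes the two sums. -/
theorem sepDist_refl {n : ℕ} {α : V n} (hα : α ∈ roots n) (x y : V n) :
    sepDist (refl α x) (refl α y) = sepDist x y := by
  classical
  unfold sepDist
  congr 1
  · congr 1
    refine Finset.sum_nbij' (refl α) (refl α) (fun v hv => refl_mem_signedBasis hα hv)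
      (fun v hv => refl_mem_signedBasis hα hv) (fun v _ => refl_refl α v)
      (fun v _ => refl_refl α v) fun v _ => ?_
    rw [inner_refl, inner_refl]
  · have hmem : ∀ q ∈ (signedBasis n).offDiag,
        (refl α q.1, refl α q.2) ∈ (signedBasis n).offDiag := by
      intro q hq
      rw [Finset.mem_offDiag] at hq ⊢
      exact ⟨refl_mem_signedBasis hα hq.1, refl_mem_signedBasis hα hq.2.1,
        fun h => hq.2.2 ((refl α).injective h)⟩
    refine Finset.sum_nbij' (fun q => (refl α q.1, refl α q.2))
      (fun q => (refl α q.1, refl α q.2)) hmem hmem (fun q _ => ?_) (fun q _ => ?_) fun q _ => ?_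
    · simp only [refl_refl]
    · simp only [refl_refl]
    · rw [inner_refl, inner_refl, refl_apply_add]

/-- The vectors ±e_j are themselves roots, so every pairing is shifted by an integer, the same for
both points. -/
theorem sepDist_trans {n : ℕ} {u : V n} (hu : u ∈ coweightLattice n) (x y : V n) :
    sepDist (trans u x) (trans u y) = sepDist x y := by
  have basis : ∀ v ∈ signedBasis n, ∃ k : ℤ, inner ℝ v u = (k : ℝ) := by
    intro v hv
    obtain ⟨m, hm, h⟩ := mem_signedBasis.1 hv
    exact hu v (.inl ⟨m, hm, h⟩)
  classical
  unfold sepDist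
  congr 1
  · congr 1
    refine Finset.sum_congr rfl fun v hv => ?_
    obtain ⟨k, hk⟩ := basis v hv
    rw [trans_apply, trans_apply, inner_add_right, inner_add_right, hk, floorDist_add_intCast]
  · refine Finset.sum_congr rfl fun q hq => ?_
    rw [Finset.mem_offDiag] at hq
    obtain ⟨k, hk⟩ := basis _ hq.1
    obtain ⟨l, hl⟩ := basis _ hq.2.1
    rw [trans_apply, trans_apply, inner_add_right, inner_add_right _ u,
      inner_add_left q.1 q.2 u, hk, hl, ← Int.cast_add, floorDist_add_intCast]

theorem sepDist_invariant {n : ℕ} {g : Aff n} (hg : g ∈ extAffineWeyl n) (x y : V n) :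
    sepDist (g x) (g y) = sepDist x y := by
  -- The maps that preserve `sepDist` form a subgroup, so generators suffice.
  let K : Subgroup (Aff n) :=
    { carrier := {g | ∀ x y, sepDist (g x) (g y) = sepDist x y}
      one_mem' := fun _ _ => rfl
      mul_mem' := fun {a b} ha hb x y => (ha (b x) (b y)).trans (hb x y)
      inv_mem' := fun {a} ha x y => by
        have h := ha (a⁻¹ x) (a⁻¹ y)
        rwa [← mul_apply, ← mul_apply, mul_inv_cancel, one_apply, one_apply, eq_comm] at h }
  have hK : extAffineWeyl n ≤ K := by
    refine sup_le ((Subgroup.closure_le K).2 ?_) ((Subgroup.closure_le K).2 ?_)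
    · rintro _ ⟨α, hα, rfl⟩
      exact sepDist_refl hα
    · rintro _ ⟨u, hu, rfl⟩
      exact sepDist_trans hu
  exact hK hg x y

/-- The contribution of the roots `± e_m` to the separation distance. -/
noncomputable def shortSep {n : ℕ} (x y : V n) (m : ℕ) : ℤ :=
  floorDist (co x m) (co y m) + floorDist (-co x m) (-co y m)

/-- The contribution of the roots `± e_m ± e_k` to the separation distance. -/
noncomputable def longSep {n : ℕ} (x y : V n) (m k : ℕ) : ℤ :=
  floorDist (co x m + co x k) (co y m + co y k) +
    floorDist (-(co x m + co x k)) (-(co y m + co y k)) +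
    floorDist (co x m - co x k) (co y m - co y k) +
    floorDist (-(co x m - co x k)) (-(co y m - co y k))

theorem longSep_comm {n : ℕ} (x y : V n) (m k : ℕ) : longSep x y m k = longSep x y k m := by
  simp only [longSep, neg_sub, add_comm (co _ m)]
  ring

/-- Index pairs with m = k drop out: equal vectors are off the diagonal's complement, and e_m +
(-e_m) = 0 separates nothing. -/
theorem sepDist_eq {n : ℕ} (x y : V n) :
    sepDist x y = 2 * ∑ m ∈ Finset.Icc 1 n, shortSep x y m +
      ∑ m ∈ Finset.Icc 1 n, ∑ k ∈ Finset.Icc 1 n, if m = k then 0 else longSep x y m k := by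
  classical
  rw [sepDist, sum_signedBasis]
  congr 1
  · simp only [shortSep, co, inner_neg_left]
  · have h : ∀ f : V n × V n → ℤ, ∑ q ∈ (signedBasis n).offDiag, f q =
        ∑ v ∈ signedBasis n, ∑ w ∈ signedBasis n, if v = w then 0 else f (v, w) := by
      intro f
      rw [show (signedBasis n).offDiag = (signedBasis n ×ˢ signedBasis n).filter
          fun q => q.1 ≠ q.2 by ext; simp [and_assoc], Finset.sum_filter, Finset.sum_product]
      refine Finset.sum_congr rfl fun v _ => Finset.sum_congr rfl fun w _ => ?_
      by_cases hvw : v = w <;> simp [hvw]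
    rw [h, sum_signedBasis]
    refine Finset.sum_congr rfl fun m hm => ?_
    rw [sum_signedBasis, sum_signedBasis, ← Finset.sum_add_distrib]
    refine Finset.sum_congr rfl fun k hk => ?_
    rw [if_neg (e_ne_neg hm k), if_neg (e_ne_neg hk m).symm]
    simp only [neg_inj, e_eq_iff hm, longSep]
    split_ifs with hmk
    · subst hmk
      simp [floorDist_self]
    · simp only [co, inner_add_left, inner_neg_left, neg_add, sub_eq_add_neg, neg_neg,
        add_comm (-inner ℝ (e n m) _)]
      ring

/-! ### The fundamental alcove -/

/-- The fundamental alcove. -/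
def alcove (n : ℕ) : Set (V n) := {x | ∀ j, 0 < affineSimpleRoot n j x}

section Alcove

variable {n : ℕ} {x y : V n}

theorem alcove_lt_succ (hx : x ∈ alcove n) {m : ℕ} (h1 : 1 ≤ m) (hm : m < n) :
    co x (m + 1) < co x m := by
  have h := hx ⟨m, by omega⟩
  rw [affineSimpleRoot, if_neg (by simp [Fin.ext_iff]; omega), simpleRoot, if_neg hm.ne,
    inner_sub_left] at h
  exact sub_pos.1 h

theorem alcove_lt (hx : x ∈ alcove n) {m k : ℕ} (h1 : 1 ≤ m) (hmk : m < k) (hk : k ≤ n) :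
    co x k < co x m := by
  induction k, hmk using Nat.le_induction with
  | base => exact alcove_lt_succ hx h1 hk
  | succ k hmk ih => exact (alcove_lt_succ hx (by omega) hk).trans (ih (by omega))

theorem alcove_pos (hx : x ∈ alcove n) {m : ℕ} (h1 : 1 ≤ m) (hm : m ≤ n) : 0 < co x m := by
  have h := hx ⟨n, by omega⟩
  rw [affineSimpleRoot, if_neg (by simp [Fin.ext_iff]; omega), simpleRoot, if_pos rfl] at h
  rcases hm.eq_or_lt with rfl | hm
  · exact h
  · exact lt_trans h (alcove_lt hx h1 hm le_rfl)

theorem alcove_theta (hx : x ∈ alcove n) : co x 1 + co x 2 < 1 := by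
  have h := hx 0
  rw [affineSimpleRoot, if_pos rfl, theta, inner_add_left] at h
  exact sub_pos.1 h

theorem alcove_le (hx : x ∈ alcove n) {m k : ℕ} (h1 : 1 ≤ m) (hmk : m ≤ k) (hk : k ≤ n) :
    co x k ≤ co x m := by
  rcases hmk.eq_or_lt with rfl | h
  · exact le_rfl
  · exact (alcove_lt hx h1 h hk).le

theorem alcove_add_lt_one (hx : x ∈ alcove n) {m k : ℕ} (h1 : 1 ≤ m) (hmk : m < k) (hk : k ≤ n) :
    co x m + co x k < 1 := by
  have := alcove_theta hx
  have := alcove_le hx le_rfl h1 (by omega)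
  have := alcove_le hx (by omega) (by omega : 2 ≤ k) hk
  linarith

theorem alcove_add_lt_one_of_ne (hx : x ∈ alcove n) {m k : ℕ} (h1 : 1 ≤ m) (h1' : 1 ≤ k)
    (hmk : m ≠ k) (hm : m ≤ n) (hk : k ≤ n) : co x m + co x k < 1 := by
  rcases hmk.lt_or_gt with h | h
  · exact alcove_add_lt_one hx h1 h hk
  · rw [add_comm]
    exact alcove_add_lt_one hx h1' h hm

theorem alcove_lt_one (hn : 2 ≤ n) (hx : x ∈ alcove n) {m : ℕ} (h1 : 1 ≤ m) (hm : m ≤ n) :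
    co x m < 1 := by
  have := alcove_theta hx
  have := alcove_pos hx (by omega : 1 ≤ 2) hn
  have := alcove_le hx le_rfl h1 hm
  linarith

theorem alcove_diagram (hx : x ∈ alcove n) {l : Aff n} (hl : l ∈ diagramGroup n) :
    l x ∈ alcove n := by
  obtain ⟨-, σ, hσ⟩ := hl
  intro j
  have h := hσ (σ⁻¹ j) x
  rw [show σ (σ⁻¹ j) = j from Equiv.apply_symm_apply σ j] at h
  rw [h]
  exact hx _

theorem alcove_nonempty (hn : 2 ≤ n) : (alcove n).Nonempty := by
  -- At this point every simple affine root takes the value 1/(2n).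
  let p : V n := WithLp.toLp 2 fun c : Fin n => ((n : ℝ) - c) / (2 * n)
  have hp : ∀ m, 1 ≤ m → m ≤ n → co p m = ((n : ℝ) + 1 - m) / (2 * n) := by
    intro m h1 hm
    obtain ⟨c, rfl⟩ := Nat.exists_eq_add_of_le' h1
    rw [co_eq p ⟨c, by omega⟩]
    simp only [p]
    push_cast
    congr 1
    ring
  have hn0 : (0 : ℝ) < 2 * n := by positivity
  refine ⟨p, fun j => ?_⟩
  rw [affineSimpleRoot]
  split_ifs with h
  · rw [theta, inner_add_left]
    change 0 < 1 - (co p 1 + co p 2)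
    rw [hp 1 le_rfl (by omega), hp 2 (by omega) hn, ← add_div, sub_pos, div_lt_one hn0]
    push_cast
    linarith
  · have h1 : (j : ℕ) ≠ 0 := fun h' => h (Fin.ext h')
    rw [simpleRoot]
    split_ifs with h'
    · change 0 < co p n
      rw [hp n (by omega) le_rfl]
      exact div_pos (by linarith) hn0
    · rw [inner_sub_left]
      change 0 < co p j - co p (j + 1)
      rw [hp j (by omega) (by omega), hp (j + 1) (by omega) (by omega), ← sub_div]
      push_cast
      exact div_pos (by linarith) hn0

/-! ### Walls crossed by a single generator -/

theorem shortSep_eq_zero {m : ℕ} (hx : 0 < co x m) (hx' : co x m < 1) (hy : 0 < co y m)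
    (hy' : co y m < 1) : shortSep x y m = 0 := by
  rw [shortSep, floorDist_eq_zero 0, floorDist_eq_zero (-1), add_zero]
  all_goals push_cast; linarith

/-- The conditions on y do not ask for `co y k` to be positive, since s_n makes the last coordinate
negative. -/
theorem longSep_eq_zero {m k : ℕ} (hx : co x k < co x m) (hx0 : 0 < co x k)
    (hx' : co x m + co x k < 1) (hy : co y k < co y m) (hy0 : 0 < co y m + co y k)
    (hy' : co y m + co y k < 1) (hy1 : co y m - co y k < 1) : longSep x y m k = 0 := by
  rw [longSep, floorDist_eq_zero 0, floorDist_eq_zero (-1), floorDist_eq_zero 0,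
    floorDist_eq_zero (-1)]
  · rfl
  all_goals push_cast; linarith

/-- The one exceptional pair occurs in both orders, with contribution at most 2 each time. -/
theorem sum_longSep_le (x y : V n) (a b : ℕ)
    (h : ∀ m k, 1 ≤ m → m < k → k ≤ n → longSep x y m k ≤ if m = a ∧ k = b then 2 else 0) :
    (∑ m ∈ Finset.Icc 1 n, ∑ k ∈ Finset.Icc 1 n, if m = k then 0 else longSep x y m k) ≤ 4 := by
  have h2 : ∀ c d : ℕ, (∑ m ∈ Finset.Icc 1 n, ∑ k ∈ Finset.Icc 1 n,
      if m = c then (if k = d then (2 : ℤ) else 0) else 0) ≤ 2 := by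
    intro c d
    have : ∀ m, (∑ k ∈ Finset.Icc 1 n, if m = c then (if k = d then (2 : ℤ) else 0) else 0) ≤
        if m = c then 2 else 0 := by
      intro m
      split_ifs
      · rw [Finset.sum_ite_eq']
        split_ifs <;> norm_num
      · simp
    refine (Finset.sum_le_sum fun m _ => this m).trans ?_
    rw [Finset.sum_ite_eq']
    split_ifs <;> norm_num
  have h3 := add_le_add (h2 a b) (h2 b a)
  simp only [← Finset.sum_add_distrib] at h3
  refine le_trans (Finset.sum_le_sum fun m hm => Finset.sum_le_sum fun k hk => ?_) h3
  rw [Finset.mem_Icc] at hm hk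
  beta_reduce
  rcases lt_trichotomy m k with hmk | hmk | hmk
  · rw [if_neg hmk.ne]
    refine (h m k hm.1 hmk hk.2).trans ?_
    split_ifs <;> omega
  · rw [if_pos hmk]
    split_ifs <;> omega
  · rw [if_neg hmk.ne', longSep_comm]
    refine (h k m hk.1 hmk hm.2).trans ?_
    split_ifs <;> omega

theorem sepDist_alcove (hn : 2 ≤ n) (hx : x ∈ alcove n) (hy : y ∈ alcove n) :
    sepDist x y ≤ 0 := by
  have hS : ∀ m ∈ Finset.Icc 1 n, shortSep x y m = 0 := by
    intro m hm
    rw [Finset.mem_Icc] at hm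
    exact shortSep_eq_zero (alcove_pos hx hm.1 hm.2) (alcove_lt_one hn hx hm.1 hm.2)
      (alcove_pos hy hm.1 hm.2) (alcove_lt_one hn hy hm.1 hm.2)
  have hL : ∀ m k, 1 ≤ m → m < k → k ≤ n → longSep x y m k = 0 := by
    intro m k h1 hmk hk
    have := alcove_pos hy (by omega : 1 ≤ k) hk
    have := alcove_pos hy h1 (by omega)
    have := alcove_add_lt_one hy h1 hmk hk
    exact longSep_eq_zero (alcove_lt hx h1 hmk hk) (alcove_pos hx (by omega) hk)
      (alcove_add_lt_one hx h1 hmk hk) (alcove_lt hy h1 hmk hk) (by linarith) (by linarith)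
      (by linarith)
  rw [sepDist_eq, Finset.sum_eq_zero hS, Finset.sum_eq_zero fun m hm =>
    Finset.sum_eq_zero fun k hk => ?_]
  · norm_num
  · rw [Finset.mem_Icc] at hm hk
    rcases lt_trichotomy m k with h | h | h
    · simp only [if_neg h.ne, hL m k hm.1 h hk.2]
    · simp only [if_pos h]
    · simp only [if_neg h.ne', longSep_comm x y m, hL k m hk.1 h hm.2]

/-- Exchanging two neighbouring coordinates reverses the order of that pair only, so only e_j -
e_{j+1} changes sign. -/
theorem sepDist_s_lt (hn : 2 ≤ n) (hx : x ∈ alcove n) (j : Fin (n + 1)) (hj : 1 ≤ (j : ℕ))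
    (hj' : (j : ℕ) < n) : sepDist x (s n j x) ≤ 4 := by
  let τ : ℕ → ℕ := fun m => if m = j then (j : ℕ) + 1 else if m = (j : ℕ) + 1 then j else m
  have hτ : ∀ m, τ m = if m = j then (j : ℕ) + 1 else if m = (j : ℕ) + 1 then (j : ℕ) else m :=
    fun _ => rfl
  have hco : ∀ m, 1 ≤ m → m ≤ n → co (s n j x) m = co x (τ m) := by
    intro m h1 hm
    rw [co_s_lt j h1 hm hj hj', hτ]
    split_ifs <;> rfl
  have hτm : ∀ m, 1 ≤ m → m ≤ n → 1 ≤ τ m ∧ τ m ≤ n := by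
    intro m h1 hm
    rw [hτ]
    split_ifs <;> omega
  have hτne : ∀ m k, m < k → τ m ≠ τ k := by
    intro m k h
    rw [hτ, hτ]
    split_ifs <;> omega
  have hτlt : ∀ m k, m < k → ¬(m = (j : ℕ) ∧ k = (j : ℕ) + 1) → τ m < τ k := by
    intro m k h h'
    rw [hτ, hτ]
    split_ifs <;> omega
  have hS : ∀ m ∈ Finset.Icc 1 n, shortSep x (s n j x) m = 0 := by
    intro m hm
    rw [Finset.mem_Icc] at hm
    have h := hτm m hm.1 hm.2
    refine shortSep_eq_zero (alcove_pos hx hm.1 hm.2) (alcove_lt_one hn hx hm.1 hm.2) ?_ ?_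
    all_goals rw [hco m hm.1 hm.2]
    · exact alcove_pos hx h.1 h.2
    · exact alcove_lt_one hn hx h.1 h.2
  rw [sepDist_eq, Finset.sum_eq_zero hS, mul_zero, zero_add]
  refine sum_longSep_le _ _ j (j + 1) fun m k h1 hmk hk => ?_
  have hm := hτm m h1 (by omega)
  have hk' := hτm k (by omega) hk
  have em := hco m h1 (by omega)
  have ek := hco k (by omega) hk
  have pm := alcove_pos hx hm.1 hm.2
  have pk := alcove_pos hx hk'.1 hk'.2
  have pmk := alcove_add_lt_one_of_ne hx hm.1 hk'.1 (hτne m k hmk) hm.2 hk'.2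
  have qm := alcove_pos hx h1 (by omega)
  have qk := alcove_pos hx (by omega : 1 ≤ k) hk
  have qmk := alcove_add_lt_one hx h1 hmk hk
  split_ifs with h
  · rw [longSep, em, ek, floorDist_eq_zero 0, floorDist_eq_zero (-1)]
    · refine (add_le_add (add_le_add le_rfl (floorDist_le_one (-1) ?_ ?_ ?_ ?_))
        (floorDist_le_one (-1) ?_ ?_ ?_ ?_)).trans_eq (by norm_num : (0 : ℤ) + 0 + 1 + 1 = 2)
      all_goals push_cast; linarith
    all_goals push_cast; linarith
  · refine (longSep_eq_zero (alcove_lt hx h1 hmk hk) qk qmk ?_ ?_ ?_ ?_).le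
    all_goals rw [em, ek]
    · exact alcove_lt hx hm.1 (hτlt m k hmk h) hk'.2
    all_goals linarith

/-- Only ±e_n change sign; the long roots keep theirs because x_m > x_n for m < n. -/
theorem sepDist_s_last (hn : 2 ≤ n) (hx : x ∈ alcove n) (j : Fin (n + 1))
    (hj : (j : ℕ) = n) : sepDist x (s n j x) ≤ 4 := by
  have hS : ∀ m ∈ Finset.Icc 1 n, shortSep x (s n j x) m ≤ if m = n then 2 else 0 := by
    intro m hm
    rw [Finset.mem_Icc] at hm
    have p := alcove_pos hx hm.1 hm.2
    have q := alcove_lt_one hn hx hm.1 hm.2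
    have c := co_s_last j hm.1 hm.2 hj x
    split_ifs at c ⊢ with h
    · rw [show co x n = co x m by rw [h]] at c
      rw [shortSep, c]
      refine (add_le_add (floorDist_le_one (-1) ?_ ?_ ?_ ?_)
        (floorDist_le_one (-1) ?_ ?_ ?_ ?_)).trans_eq (by norm_num : (1 : ℤ) + 1 = 2)
      all_goals push_cast; linarith
    · rw [shortSep, c, floorDist_self, floorDist_self, add_zero]
  have hS' := Finset.sum_le_sum hS
  rw [Finset.sum_ite_eq', if_pos (by simp; omega)] at hS'
  have hL : ∀ m k, 1 ≤ m → m < k → k ≤ n → longSep x (s n j x) m k = 0 := by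
    intro m k h1 hmk hk
    have lt := alcove_lt hx h1 hmk hk
    have pm := alcove_pos hx h1 (by omega)
    have pk := alcove_pos hx (by omega : 1 ≤ k) hk
    have pmk := alcove_add_lt_one hx h1 hmk hk
    have cm := co_s_last j h1 (by omega) hj x
    have ck := co_s_last j (by omega : 1 ≤ k) hk hj x
    rw [if_neg (by omega)] at cm
    split_ifs at ck with h
    · rw [show co x n = co x k by rw [h]] at ck
      refine longSep_eq_zero lt pk pmk ?_ ?_ ?_ ?_
      all_goals rw [cm, ck]; linarith
    · refine longSep_eq_zero lt pk pmk ?_ ?_ ?_ ?_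
      all_goals rw [cm, ck]; linarith
  have hL' : (∑ m ∈ Finset.Icc 1 n, ∑ k ∈ Finset.Icc 1 n,
      if m = k then 0 else longSep x (s n j x) m k) = 0 := by
    refine Finset.sum_eq_zero fun m hm => Finset.sum_eq_zero fun k hk => ?_
    rw [Finset.mem_Icc] at hm hk
    split_ifs with h
    · rfl
    · rcases Ne.lt_or_gt h with h | h
      · exact hL m k hm.1 h hk.2
      · rw [longSep_comm]
        exact hL k m hk.1 h hm.2
  rw [sepDist_eq, hL']
  linarith

/-- The value of θ passes from a to 2 - a across 1. All other positive roots stay between 0 and 1,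
because 1 - x_2 + x_k < 1 for k > 2, and likewise with x_1. -/
theorem sepDist_s_zero (hn : 2 ≤ n) (hx : x ∈ alcove n) : sepDist x (s n 0 x) ≤ 4 := by
  have p1 := alcove_pos hx le_rfl (by omega)
  have p2 := alcove_pos hx (by omega : 1 ≤ 2) hn
  have p12 := alcove_theta hx
  have lt12 := alcove_lt hx le_rfl (by omega : 1 < 2) hn
  have hS : ∀ m ∈ Finset.Icc 1 n, shortSep x (s n 0 x) m = 0 := by
    intro m hm
    rw [Finset.mem_Icc] at hm
    have p := alcove_pos hx hm.1 hm.2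
    have q := alcove_lt_one hn hx hm.1 hm.2
    have c := co_s_zero hn hm.1 hm.2 x
    refine shortSep_eq_zero p q ?_ ?_
    all_goals rw [c]; split_ifs <;> linarith
  rw [sepDist_eq, Finset.sum_eq_zero hS, mul_zero, zero_add]
  refine sum_longSep_le _ _ 1 2 fun m k h1 hmk hk => ?_
  have lt := alcove_lt hx h1 hmk hk
  have pm := alcove_pos hx h1 (by omega)
  have pk := alcove_pos hx (by omega : 1 ≤ k) hk
  have pmk := alcove_add_lt_one hx h1 hmk hk
  have cm := co_s_zero hn h1 (by omega) x
  have ck := co_s_zero hn (by omega : 1 ≤ k) hk x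
  split_ifs with h
  · obtain ⟨rfl, rfl⟩ := h
    rw [if_pos rfl] at cm
    rw [if_neg (by omega), if_pos rfl] at ck
    rw [longSep, cm, ck, floorDist_eq_zero 0 (a := co x 1 - co x 2),
      floorDist_eq_zero (-1) (a := -(co x 1 - co x 2))]
    · refine (add_le_add (add_le_add (add_le_add (floorDist_le_one 0 ?_ ?_ ?_ ?_)
        (floorDist_le_one (-2) ?_ ?_ ?_ ?_)) le_rfl) le_rfl).trans_eq
          (by norm_num : (1 : ℤ) + 1 + 0 + 0 = 2)
      all_goals push_cast; linarith
    all_goals push_cast; linarith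
  · rw [if_neg (by omega), if_neg (by omega)] at ck
    have lt2 := alcove_lt hx (by omega) (by omega : 2 < k) hk
    refine (longSep_eq_zero lt pk pmk ?_ ?_ ?_ ?_).le
    all_goals rw [cm, ck]; split_ifs <;> linarith

theorem sepDist_s (hn : 2 ≤ n) (hx : x ∈ alcove n) (j : Fin (n + 1)) :
    sepDist x (s n j x) ≤ 4 := by
  by_cases h0 : j = 0
  · rw [h0]
    exact sepDist_s_zero hn hx
  have h1 : (j : ℕ) ≠ 0 := fun h => h0 (Fin.ext h)
  by_cases hj : (j : ℕ) = n
  · exact sepDist_s_last hn hx j hj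
  · exact sepDist_s_lt hn hx j (by omega) (by omega)

/-! ### Displacement by words and by ω_i -/

/-- By invariance, the step from g x to g s_j x costs as much as the step from x to s_j x, which
starts in the alcove whatever g is. -/
theorem sepDist_mul_wordProd (hn : 2 ≤ n) (hx : x ∈ alcove n) (L : List (Fin (n + 1))) {g : Aff n}
    (hg : g ∈ extAffineWeyl n) :
    sepDist x ((g * wordProd n L) x) ≤ sepDist x (g x) + 4 * L.length := by
  induction L generalizing g with
  | nil => simp [wordProd_nil]
  | cons j L ih =>
    have h := ih (mul_mem hg (s_mem n hn j))
    have h1 := sepDist_triangle x (g x) ((g * s n j) x)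
    have h2 := sepDist_s hn hx j
    rw [← sepDist_invariant hg] at h2
    rw [mul_apply g (s n j)] at h1
    rw [mul_apply g (s n j)] at h
    rw [wordProd_cons, ← mul_assoc, List.length_cons]
    push_cast
    linarith

theorem sepDist_omega (i : ℕ) (hin : i ≤ n) (x : V n) :
    sepDist x (omega n i x) = 4 * (i * (2 * n - i)) := by
  let w : ℕ → ℤ := fun m => if m ≤ i then 1 else 0
  have hw : ∀ m, w m = 0 ∨ w m = 1 := by
    intro m
    simp only [w]
    split_ifs <;> simp
  have hco : ∀ m ∈ Finset.Icc 1 n, co (omega n i x) m = (w m : ℝ) + co x m := by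
    intro m hm
    rw [Finset.mem_Icc] at hm
    rw [co_omega hm.1 hm.2]
    simp [w]
  have hsum : ∑ m ∈ Finset.Icc 1 n, w m = i := by
    rw [Finset.sum_ite, Finset.sum_const_zero, add_zero, Finset.sum_const,
      show (Finset.Icc 1 n).filter (· ≤ i) = Finset.Icc 1 i by ext; simp; omega]
    simp
  have hS : ∀ m ∈ Finset.Icc 1 n, shortSep x (omega n i x) m = 2 * w m := by
    intro m hm
    rw [shortSep, hco m hm, floorDist_intCast_add,
      show -((w m : ℝ) + co x m) = ((-w m : ℤ) : ℝ) + -co x m by push_cast; ring,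
      floorDist_intCast_add]
    rcases hw m with h | h <;> rw [h] <;> norm_num
  -- A pair m ≠ k contributes 4 exactly when one of m, k is at most i: as 2+2+0+0 if both are, as
  -- 1+1+1+1 if one is. The subtracted term removes the diagonal, where w m + w m - w m * w m = w m.
  have hL : ∀ m ∈ Finset.Icc 1 n, ∀ k ∈ Finset.Icc 1 n,
      (if m = k then 0 else longSep x (omega n i x) m k) =
        4 * (w m + w k - w m * w k) - if m = k then 4 * w m else 0 := by
    intro m hm k hk
    split_ifs with h
    · subst h
      rcases hw m with h | h <;> rw [h] <;> norm_num
    · rw [longSep, hco m hm, hco k hk,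
        show ((w m : ℝ) + co x m + (w k + co x k)) = ((w m + w k : ℤ) : ℝ) + (co x m + co x k) by
          push_cast; ring,
        show (-(((w m + w k : ℤ) : ℝ) + (co x m + co x k))) =
          ((-(w m + w k) : ℤ) : ℝ) + -(co x m + co x k) by push_cast; ring,
        show ((w m : ℝ) + co x m - (w k + co x k)) = ((w m - w k : ℤ) : ℝ) + (co x m - co x k) by
          push_cast; ring,
        show (-(((w m - w k : ℤ) : ℝ) + (co x m - co x k))) =
          ((-(w m - w k) : ℤ) : ℝ) + -(co x m - co x k) by push_cast; ring]
      simp only [floorDist_intCast_add]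
      rcases hw m with h | h <;> rcases hw k with h' | h' <;> rw [h, h'] <;> norm_num
  rw [sepDist_eq, Finset.sum_congr rfl hS, Finset.sum_congr rfl fun m hm =>
    Finset.sum_congr rfl (hL m hm), ← Finset.mul_sum, hsum]
  have hd : ∀ m ∈ Finset.Icc 1 n, (∑ k ∈ Finset.Icc 1 n,
      (4 * (w m + w k - w m * w k) - if m = k then 4 * w m else 0)) =
        4 * (n * w m + i - w m * i) - 4 * w m := by
    intro m hm
    rw [Finset.sum_sub_distrib, Finset.sum_ite_eq, if_pos hm, ← Finset.mul_sum,
      Finset.sum_sub_distrib, Finset.sum_add_distrib, ← Finset.mul_sum, hsum, Finset.sum_const]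
    simp
  rw [Finset.sum_congr rfl hd, Finset.sum_sub_distrib, ← Finset.mul_sum, ← Finset.mul_sum,
    Finset.sum_sub_distrib, Finset.sum_add_distrib, ← Finset.mul_sum, ← Finset.sum_mul, hsum,
    Finset.sum_const]
  simp
  ring

end Alcove

theorem le_length_of_omega_eq {n i : ℕ} (hn : 2 ≤ n) (hin : i ≤ n) {l : Aff n}
    (hl : l ∈ diagramGroup n) {L : List (Fin (n + 1))} (h : omega n i = l * wordProd n L) :
    i * (2 * n - i) ≤ L.length := by
  obtain ⟨x, hx⟩ := alcove_nonempty hn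
  have h1 := sepDist_mul_wordProd hn hx L hl.1
  have h2 := sepDist_alcove hn hx (alcove_diagram hx hl)
  rw [← h, sepDist_omega i hin] at h1
  zify [show i ≤ 2 * n by omega]
  linarith

theorem length_omega_of_eq {n i : ℕ} (hn : 2 ≤ n) (hin : i ≤ n) {l : Aff n}
    (hl : l ∈ diagramGroup n) {L : List (Fin (n + 1))} (h : omega n i = l * wordProd n L)
    (hL : L.length = i * (2 * n - i)) : length n (omega n i) = i * (2 * n - i) := by
  -- The infimum of the empty set would be 0; the given expression shows that the set is not empty.
  refine le_antisymm (Nat.sInf_le ⟨l, hl, L, hL, h⟩) (le_csInf ⟨_, l, hl, L, hL, h⟩ ?_)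
  rintro r ⟨l', hl', L', rfl, h'⟩
  exact le_length_of_omega_eq hn hin hl' h'

end AffineB

theorem mainTheorem6 (n i : ℕ) (hn : 2 ≤ n) (hi : 1 ≤ i) (hin : i ≤ n) :
    (Odd i →
      AffineB.omega n i =
        AffineB.piOne n * AffineB.wordProd n (AffineB.seg n 1 n) *
          (AffineB.s n 0 * AffineB.wordProd n (AffineB.seg n 2 n) *
            AffineB.wordProd n (AffineB.seg n 1 n)) ^ ((i - 1) / 2) *
          AffineB.wordProd n (AffineB.tail n i) ∧
      AffineB.IsReducedExpression n (AffineB.omega n i) (AffineB.piOne n) (AffineB.oddWord n i) ∧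
      (AffineB.oddWord n i).length = i * (2 * n - i)) ∧
    (Even i →
      AffineB.omega n i =
        (AffineB.s n 0 * AffineB.wordProd n (AffineB.seg n 2 n) *
            AffineB.wordProd n (AffineB.seg n 1 n)) ^ (i / 2) *
          AffineB.wordProd n (AffineB.tail n i) ∧
      AffineB.IsReducedExpression n (AffineB.omega n i) 1 (AffineB.evenWord n i) ∧
      (AffineB.evenWord n i).length = i * (2 * n - i)) ∧
    AffineB.length n (AffineB.omega n i) = i * (2 * n - i) := by
  have odd (h : Odd i) : AffineB.omega n i =
      AffineB.piOne n * AffineB.wordProd n (AffineB.oddWord n i) := by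
    rw [AffineB.omega_odd hn hi hin h, AffineB.wordProd_oddWord]
    simp only [mul_assoc]
  have even (h : Even i) : AffineB.omega n i =
      1 * AffineB.wordProd n (AffineB.evenWord n i) := by
    rw [AffineB.omega_even hn hi hin h, AffineB.wordProd_evenWord, one_mul]
  have hlen : AffineB.length n (AffineB.omega n i) = i * (2 * n - i) := by
    rcases Nat.even_or_odd i with h | h
    · exact AffineB.length_omega_of_eq hn hin (one_mem _) (even h)
        (AffineB.length_evenWord hn hin h)
    · exact AffineB.length_omega_of_eq hn hin (AffineB.piOne_mem n hn) (odd h)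
        (AffineB.length_oddWord hn hin h)
  refine ⟨fun h => ⟨?_, ⟨AffineB.piOne_mem n hn, odd h, ?_⟩, AffineB.length_oddWord hn hin h⟩,
    fun h => ⟨?_, ⟨one_mem _, even h, ?_⟩, AffineB.length_evenWord hn hin h⟩, hlen⟩
  · rw [← AffineB.wordProd_block]
    exact AffineB.omega_odd hn hi hin h
  · rw [hlen, AffineB.length_oddWord hn hin h]
  · rw [← AffineB.wordProd_block]
    exact AffineB.omega_even hn hi hin h
  · rw [hlen, AffineB.length_evenWord hn hin h]
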